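/- Let $A$ be a Hopf algebra over $\mathbb{C}$ with comultiplication $\Delta$ and counit $\varepsilon$, and let $B\subseteq A$ be a left coideal subalgebra, i.e. a unital subalgebra with $\Delta(B)\subseteq A\otimes B$. Write $\Delta(a)=a_{(1)}\otimes a_{(2)}$, $b^+=b-\varepsilon(b)1$, $B^+=\{b^+\mid b\in B\}=\{b\in B\mid\varepsilon(b)=0\}$, $\overline{A}=A/(B^+A)$ (where $B^+A$ is the linear span of all products), and let $\overline{\Delta}:A\to\overline{A}\otimes A$, $\overline{\Delta}(a)=\overline{a_{(1)}}\otimes a_{(2)}$. A derivation of $B$ is a $\mathbb{C}$-linear map $\delta$ from $B$ into a $B$-bimodule with $\delta(ab)=a\,\delta b+\delta a\,b$ for all $a,b\in B$; put $\Gamma(\delta)=\mathrm{Lin}_{\mathbb{C}}\{a\,\delta b\mid a,b\in B\}$. Write $\delta\le\delta'$ if the linear map $\Gamma(\delta')\to\Gamma(\delta)$, $a\,\delta' b\mapsto a\,\delta b$, is well defined; derivations with $\delta\le\delta'$ and $\delta'\le\delta$ are considered identical. A derivation $\delta$ is equivariant if the linear map $\Gamma(\delta)\to A\otimes\Gamma(\delta)$,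 $a\,\delta b\mapsto a_{(1)}b_{(1)}\otimes a_{(2)}\,\delta b_{(2)}$, is well defined. For a right ideal $R$ of $B^+$ with canonical projection $p:B^+\to B^+/R$, let $\delta_R:B\to A\otimes(B^+/R)$ be the derivation $\delta_R b=b_{(1)}\otimes p(b_{(2)}^+)$, where $A\otimes(B^+/R)$ is a $B$-bimodule by $b\,(a\otimes p(x))\,c=b\,a\,c_{(1)}\otimes p(x\,c_{(2)})$; thus $a\,\delta_R b=a\,b_{(1)}\otimes p(b_{(2)}^+)$. For a derivation $\delta$ of $B$, let $R_\delta=\{\sum_i\varepsilon(a_i)\,b_i^+\mid\sum_i a_i\,\delta b_i=0\}$, which is a right ideal of $B^+$. Theorem. Suppose that $A$ is faithfully flat as a right $B$-module, i.e. the functor $M\mapsto A\otimes_B M$ from left $B$-modules to complex vector spaces preserves and reflects exact sequences. Then $R\mapsto\delta_R$ and $\delta\mapsto R_\delta$ are mutually inverse bijections between the set of right ideals $R$ of $B^+$ with $\overline{\Delta}(R)\subseteq\overline{A}\otimes R$ and the set of equivariant derivations of $B$ (up to the above identification). -/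

import Mathlib

open scoped TensorProduct

universe u

noncomputable section

namespace QHS

section Coideal

variable {A : Type u} [Ring A] [HopfAlgebra ℂ A]

/-- The subalgebra `B` of `A` is a left coideal: `Δ(B) ⊆ A ⊗ B`, where `A ⊗ B` is viewed as a
subspace of `A ⊗ A`. -/
def IsLeftCoideal (B : Subalgebra ℂ A) : Prop :=
  ∀ b ∈ B, Coalgebra.comul (R := ℂ) b ∈ LinearMap.range (B.val.toLinearMap.lTensor A)

variable (B : Subalgebra ℂ A)

theorem lTensor_val_injective :
    Function.Injective (B.val.toLinearMap.lTensor A) :=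
  Module.Flat.lTensor_preserves_injective_linearMap _ Subtype.val_injective

variable {B}

/-- The comultiplication of `A`, restricted to a linear map `B → A ⊗ B`. -/
def coactLin (hB : IsLeftCoideal B) : B →ₗ[ℂ] A ⊗[ℂ] B :=
  (LinearEquiv.ofInjective _ (lTensor_val_injective B)).symm.toLinearMap ∘ₗ
    (Coalgebra.comul ∘ₗ B.val.toLinearMap).codRestrict
      (LinearMap.range (B.val.toLinearMap.lTensor A)) (fun b => hB b.1 b.2)

theorem lTensor_coactLin (hB : IsLeftCoideal B) (b : B) :
    B.val.toLinearMap.lTensor A (coactLin hB b) = Coalgebra.comul (R := ℂ) (b : A) := by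
  have h := LinearEquiv.apply_symm_apply (LinearEquiv.ofInjective _ (lTensor_val_injective B))
    ((Coalgebra.comul ∘ₗ B.val.toLinearMap).codRestrict
      (LinearMap.range (B.val.toLinearMap.lTensor A)) (fun b => hB b.1 b.2) b)
  exact congrArg Subtype.val h

theorem lTensor_val_eq_map (x : A ⊗[ℂ] B) :
    B.val.toLinearMap.lTensor A x = Algebra.TensorProduct.map (AlgHom.id ℂ A) B.val x := rfl

theorem coactLin_one (hB : IsLeftCoideal B) : coactLin hB 1 = 1 := by
  apply lTensor_val_injective B
  rw [lTensor_coactLin, lTensor_val_eq_map, map_one]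
  exact Bialgebra.comul_one

theorem coactLin_mul (hB : IsLeftCoideal B) (b c : B) :
    coactLin hB (b * c) = coactLin hB b * coactLin hB c := by
  apply lTensor_val_injective B
  rw [lTensor_coactLin, lTensor_val_eq_map, map_mul, ← lTensor_val_eq_map, ← lTensor_val_eq_map,
    lTensor_coactLin, lTensor_coactLin]
  exact Bialgebra.comul_mul _ _

variable (B)

/-- The restriction of the counit to `B`. -/
def counitB : B →ₗ[ℂ] ℂ := Coalgebra.counit ∘ₗ B.val.toLinearMap

theorem counitB_one : counitB B 1 = 1 := Bialgebra.counit_one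

theorem counitB_mul (b c : B) : counitB B (b * c) = counitB B b * counitB B c :=
  Bialgebra.counit_mul _ _

variable {B}

theorem counit_coactLin (hB : IsLeftCoideal B) (b : B) :
    TensorProduct.rid ℂ A ((counitB B).lTensor A (coactLin hB b)) = (b : A) := by
  have h := Coalgebra.lTensor_counit_comul (R := ℂ) (b : A)
  rw [← lTensor_coactLin hB b, ← LinearMap.comp_apply, ← LinearMap.lTensor_comp] at h
  have h2 : (counitB B).lTensor A (coactLin hB b) = (b : A) ⊗ₜ[ℂ] (1 : ℂ) := h
  rw [h2]; simp

end Coideal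

section Augmentation

variable {A : Type u} [Ring A] [HopfAlgebra ℂ A] (B : Subalgebra ℂ A)

/-- `B⁺ = {b ∈ B | ε(b) = 0}`, which is also the set of all `b⁺ = b - ε(b) 1` with `b ∈ B`. -/
def Bplus : Submodule ℂ B := LinearMap.ker (counitB B)

/-- The map `b ↦ b⁺ = b - ε(b) 1`. -/
def plus : B →ₗ[ℂ] Bplus B :=
  (LinearMap.id - (counitB B).smulRight (1 : B)).codRestrict (Bplus B) (fun b => by
    simp [Bplus, counitB_one])

theorem coe_plus (b : B) : (plus B b : B) = b - counitB B b • (1 : B) := rfl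

theorem plus_surjective : Function.Surjective (plus B) := by
  rintro ⟨b, hb⟩
  refine ⟨b, Subtype.ext ?_⟩
  rw [coe_plus, show counitB B b = 0 from hb]
  simp

variable {B} in
theorem mul_mem_Bplus {x : B} (hx : x ∈ Bplus B) (c : B) : x * c ∈ Bplus B := by
  have hx' : counitB B x = 0 := hx
  change counitB B (x * c) = 0
  rw [counitB_mul, hx', zero_mul]

/-- Right multiplication by `c ∈ B` on `B⁺`. -/
def rmul (c : B) : Bplus B →ₗ[ℂ] Bplus B :=
  ((LinearMap.mulRight ℂ c) ∘ₗ (Bplus B).subtype).codRestrict (Bplus B)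
    (fun x => mul_mem_Bplus x.2 c)

theorem coe_rmul (c : B) (x : Bplus B) : (rmul B c x : B) = (x : B) * c := rfl

/-- A right ideal of the (nonunital) algebra `B⁺`. -/
@[ext]
structure RightIdeal where
  /-- The underlying linear subspace of `B⁺`. -/
  carrier : Submodule ℂ (Bplus B)
  mul_mem : ∀ r ∈ carrier, ∀ c : Bplus B, rmul B (c : B) r ∈ carrier

variable {B}

theorem RightIdeal.rmul_mem (R : RightIdeal B) (c : B) {r : Bplus B} (hr : r ∈ R.carrier) :
    rmul B c r ∈ R.carrier := by
  have h : rmul B c r = rmul B (plus B c : B) r + counitB B c • r := by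
    apply Subtype.ext
    simp [coe_rmul, coe_plus, mul_sub]
  rw [h]
  exact R.carrier.add_mem (R.mul_mem r hr _) (R.carrier.smul_mem _ hr)

/-- The linear subspace `B⁺A` of `A`. -/
def BplusA (B : Subalgebra ℂ A) : Submodule ℂ A :=
  Submodule.span ℂ {x | ∃ b ∈ Bplus B, ∃ a : A, x = (b : A) * a}

/-- The map `Δ̄ : A → Ā ⊗ A`, `Δ̄ = (¯ ⊗ id) ∘ Δ`, where `Ā = A / B⁺A`. -/
def comulBar (B : Subalgebra ℂ A) : A →ₗ[ℂ] (A ⧸ BplusA B) ⊗[ℂ] A :=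
  (BplusA B).mkQ.rTensor A ∘ₗ Coalgebra.comul

/-- The inclusion of a right ideal of `B⁺` into `A`. -/
def RightIdeal.incl (R : RightIdeal B) : R.carrier →ₗ[ℂ] A :=
  B.val.toLinearMap ∘ₗ (Bplus B).subtype ∘ₗ R.carrier.subtype

/-- The condition `Δ̄(R) ⊆ Ā ⊗ R`, where `Ā ⊗ R` is viewed as a subspace of `Ā ⊗ A`. -/
def RightIdeal.IsStable (R : RightIdeal B) : Prop :=
  ∀ r : R.carrier, comulBar B (R.incl r) ∈ LinearMap.range (R.incl.lTensor (A ⧸ BplusA B))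

end Augmentation

section Flat

variable {A : Type u} [Ring A] [Algebra ℂ A] (B : Subalgebra ℂ A)

/-- The subspace of `A ⊗ M` spanned by all `a b ⊗ m - a ⊗ b m` with `b ∈ B`. -/
def balanced (M : Type u) [AddCommGroup M] [Module ℂ M] [Module B M] :
    Submodule ℂ (A ⊗[ℂ] M) :=
  Submodule.span ℂ {x | ∃ (a : A) (b : B) (m : M), x = (a * b) ⊗ₜ[ℂ] m - a ⊗ₜ[ℂ] (b • m)}

/-- The tensor product `A ⊗_B M` of the right `B`-module `A` with the left `B`-module `M`. -/
abbrev TensorB (M : Type u) [AddCommGroup M] [Module ℂ M] [Module B M] : Type u :=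
  (A ⊗[ℂ] M) ⧸ balanced B M

variable {B} in
/-- The map `A ⊗_B f : A ⊗_B M → A ⊗_B N` induced by a `B`-linear map `f : M → N`. -/
def tensorBMap {M N : Type u} [AddCommGroup M] [Module ℂ M] [Module B M] [IsScalarTower ℂ B M]
    [AddCommGroup N] [Module ℂ N] [Module B N] [IsScalarTower ℂ B N] (f : M →ₗ[B] N) :
    TensorB B M →ₗ[ℂ] TensorB B N :=
  (balanced B M).mapQ (balanced B N) ((f.restrictScalars ℂ).lTensor A) (by
    rw [balanced, Submodule.span_le]
    rintro _ ⟨a, b, m, rfl⟩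
    apply Submodule.subset_span
    exact ⟨a, b, f m, by simp⟩)

/-- `A` is faithfully flat as a right `B`-module: the functor `M ↦ A ⊗_B M` from left `B`-modules
to complex vector spaces preserves and reflects exact sequences. -/
def IsFaithfullyFlatRight : Prop :=
  ∀ (M N P : Type u) [AddCommGroup M] [Module ℂ M] [Module B M] [IsScalarTower ℂ B M]
    [AddCommGroup N] [Module ℂ N] [Module B N] [IsScalarTower ℂ B N]
    [AddCommGroup P] [Module ℂ P] [Module B P] [IsScalarTower ℂ B P]
    (f : M →ₗ[B] N) (g : N →ₗ[B] P),
    Function.Exact f g ↔ Function.Exact (tensorBMap f) (tensorBMap g)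

end Flat

section Derivations

open MulOpposite

variable {A : Type u} [Ring A] [HopfAlgebra ℂ A]

/-- A derivation of `B`: a complex-linear map `d` from `B` into some `B`-bimodule, satisfying the
Leibniz rule. Right actions of `B` are written as left actions of the opposite algebra. -/
structure Deriv (B : Subalgebra ℂ A) where
  /-- The bimodule. -/
  M : Type u
  [addCommGroup : AddCommGroup M]
  [module : Module ℂ M]
  [leftModule : Module B M]
  [rightModule : Module Bᵐᵒᵖ M]
  [leftTower : IsScalarTower ℂ B M]
  [rightTower : IsScalarTower ℂ Bᵐᵒᵖ M]
  [bimodule : SMulCommClass B Bᵐᵒᵖ M]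
  /-- The derivation. -/
  d : B →ₗ[ℂ] M
  leibniz : ∀ a b : B, d (a * b) = a • d b + op b • d a

attribute [instance] Deriv.addCommGroup Deriv.module Deriv.leftModule Deriv.rightModule
  Deriv.leftTower Deriv.rightTower Deriv.bimodule

namespace Deriv

variable {B : Subalgebra ℂ A} (δ δ' : Deriv B)

/-- `Γ(δ)`, the complex-linear span of all `a δ b`. -/
def Gamma : Submodule ℂ δ.M := Submodule.span ℂ {x | ∃ a b : B, x = a • δ.d b}

/-- The element `a δ b` of `Γ(δ)`. -/
def form (a b : B) : δ.Gamma := ⟨a • δ.d b, Submodule.subset_span ⟨a, b, rfl⟩⟩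

/-- The linear map `B ⊗ B → Γ(δ)`, `a ⊗ b ↦ a δ b`. -/
def formLin : B ⊗[ℂ] B →ₗ[ℂ] δ.Gamma :=
  TensorProduct.lift (LinearMap.mk₂ ℂ δ.form
    (fun a a' b => Subtype.ext (add_smul a a' (δ.d b)))
    (fun z a b => Subtype.ext (smul_assoc z a (δ.d b)))
    (fun a b b' => Subtype.ext (by simp [form]))
    (fun z a b => Subtype.ext (by
      change a • δ.d (z • b) = z • (a • δ.d b)
      rw [map_smul, ← algebraMap_smul B z (δ.d b), ← algebraMap_smul B z (a • δ.d b), smul_smul,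
        smul_smul, Algebra.commutes])))

theorem formLin_tmul (a b : B) : δ.formLin (a ⊗ₜ[ℂ] b) = δ.form a b := rfl

theorem formLin_surjective : Function.Surjective δ.formLin := by
  rintro ⟨x, hx⟩
  have h : δ.Gamma ≤ (LinearMap.range δ.formLin).map δ.Gamma.subtype := by
    apply Submodule.span_le.2
    rintro _ ⟨a, b, rfl⟩
    exact ⟨δ.form a b, ⟨a ⊗ₜ b, rfl⟩, rfl⟩
  obtain ⟨y, ⟨t, rfl⟩, ht⟩ := h hx
  exact ⟨t, Subtype.ext ht⟩

/-- `δ ≤ δ'` if and only if `Γ(δ') → Γ(δ)`, `a δ' b ↦ a δ b` is a well-defined linear map. -/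
instance : Preorder (Deriv B) where
  le δ δ' := ∃ φ : δ'.Gamma →ₗ[ℂ] δ.Gamma, ∀ a b : B, φ (δ'.form a b) = δ.form a b
  le_refl _ := ⟨LinearMap.id, fun _ _ => rfl⟩
  le_trans _ _ _ := fun ⟨φ, hφ⟩ ⟨ψ, hψ⟩ => ⟨φ ∘ₗ ψ, fun a b => by simp [hφ, hψ]⟩

/-- The linear map `(A ⊗ B) ⊗ (A ⊗ B) → A ⊗ Γ(δ)`, `(x ⊗ a) ⊗ (y ⊗ b) ↦ x y ⊗ a δ b`. -/
def diagForm : (A ⊗[ℂ] B) ⊗[ℂ] (A ⊗[ℂ] B) →ₗ[ℂ] A ⊗[ℂ] δ.Gamma :=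
  TensorProduct.map (LinearMap.mul' ℂ A) δ.formLin ∘ₗ
    (TensorProduct.tensorTensorTensorComm ℂ A B A B).toLinearMap

theorem diagForm_tmul (x y : A) (a b : B) :
    δ.diagForm ((x ⊗ₜ a) ⊗ₜ (y ⊗ₜ b)) = (x * y) ⊗ₜ[ℂ] δ.form a b := rfl

/-- `δ` is equivariant if and only if the linear map
`Γ(δ) → A ⊗ Γ(δ)`, `a δ b ↦ a₍₁₎ b₍₁₎ ⊗ a₍₂₎ δ b₍₂₎` is well-defined. -/
def IsEquivariant (hB : IsLeftCoideal B) : Prop :=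
  ∃ Φ : δ.Gamma →ₗ[ℂ] A ⊗[ℂ] δ.Gamma,
    ∀ a b : B, Φ (δ.form a b) = δ.diagForm (coactLin hB a ⊗ₜ coactLin hB b)

variable {δ δ'} in
theorem IsEquivariant.congr {hB : IsLeftCoideal B} (h : δ.IsEquivariant hB) (h₁ : δ ≤ δ')
    (h₂ : δ' ≤ δ) : δ'.IsEquivariant hB := by
  obtain ⟨Φ, hΦ⟩ := h
  obtain ⟨φ, hφ⟩ := h₁
  obtain ⟨ψ, hψ⟩ := h₂
  refine ⟨ψ.lTensor A ∘ₗ Φ ∘ₗ φ, fun a b => ?_⟩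
  have key : ψ.lTensor A ∘ₗ δ.diagForm = δ'.diagForm := by
    ext x a y b
    simp [diagForm_tmul, hψ]
  rw [LinearMap.comp_apply, LinearMap.comp_apply, hφ, hΦ, ← LinearMap.comp_apply, key]

/-- The linear map `B ⊗ B → B⁺`, `a ⊗ b ↦ ε(a) b⁺`. -/
def counitPlus (B : Subalgebra ℂ A) : B ⊗[ℂ] B →ₗ[ℂ] Bplus B :=
  TensorProduct.lift ((LinearMap.lsmul ℂ (Bplus B)).compl₁₂ (counitB B) (plus B))

theorem counitPlus_tmul (a b : B) : counitPlus B (a ⊗ₜ b) = counitB B a • plus B b := rfl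

/-- The linear map `a ⊗ b ↦ a ⊗ b c - a b ⊗ c`. -/
def rshift (c : B) : B ⊗[ℂ] B →ₗ[ℂ] B ⊗[ℂ] B :=
  (LinearMap.mulRight ℂ c).lTensor B -
    (TensorProduct.mk ℂ B B).flip c ∘ₗ LinearMap.mul' ℂ B

theorem rshift_tmul (a b c : B) : rshift c (a ⊗ₜ[ℂ] b) = a ⊗ₜ (b * c) - (a * b) ⊗ₜ c := rfl

theorem coe_formLin_rshift (c : B) (t : B ⊗[ℂ] B) :
    (δ.formLin (rshift c t) : δ.M) = op c • (δ.formLin t : δ.M) := by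
  induction t with
  | zero => simp
  | add x y hx hy => simp [hx, hy]
  | tmul a b =>
    rw [rshift_tmul, map_sub, formLin_tmul, formLin_tmul, formLin_tmul]
    change a • δ.d (b * c) - (a * b) • δ.d c = op c • a • δ.d b
    rw [δ.leibniz, smul_add, smul_smul, ← smul_comm a (op c), add_sub_cancel_left]

theorem counitPlus_rshift (c : B) (t : B ⊗[ℂ] B) :
    counitPlus B (rshift c t) = rmul B c (counitPlus B t) := by
  induction t with
  | zero => simp
  | add x y hx hy => simp [hx, hy]
  | tmul a b =>
    rw [rshift_tmul, map_sub, counitPlus_tmul, counitPlus_tmul, counitPlus_tmul]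
    apply Subtype.ext
    simp [coe_rmul, coe_plus, counitB_mul, smul_sub, sub_mul, smul_smul, mul_assoc]

/-- The right ideal `R_δ = {∑ ε(aᵢ) bᵢ⁺ | ∑ aᵢ δ bᵢ = 0}` of `B⁺`. -/
def toRightIdeal : RightIdeal B where
  carrier := (LinearMap.ker δ.formLin).map (counitPlus B)
  mul_mem := by
    rintro _ ⟨t, ht, rfl⟩ c
    refine ⟨rshift (c : B) t, ?_, counitPlus_rshift _ _⟩
    have ht' : δ.formLin t = 0 := ht
    change δ.formLin _ = 0
    apply Subtype.ext
    rw [coe_formLin_rshift, ht']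
    simp

variable {δ δ'} in
theorem toRightIdeal_anti (h : δ ≤ δ') :
    δ'.toRightIdeal.carrier ≤ δ.toRightIdeal.carrier := by
  obtain ⟨φ, hφ⟩ := h
  apply Submodule.map_mono
  intro t ht
  have key : φ ∘ₗ δ'.formLin = δ.formLin := by
    ext a b
    simp [formLin_tmul, hφ]
  have ht' : δ'.formLin t = 0 := ht
  change δ.formLin t = 0
  rw [← key, LinearMap.comp_apply, ht', map_zero]

end Deriv

section Construction

variable {B : Subalgebra ℂ A} (R : RightIdeal B)

/-- Right multiplication of `B` on `B⁺ / R`. -/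
def rmulQ : B →ₗ[ℂ] Module.End ℂ (Bplus B ⧸ R.carrier) where
  toFun c := R.carrier.mapQ R.carrier (rmul B c) (fun _ hr => R.rmul_mem c hr)
  map_add' c c' := by
    ext x
    simp only [LinearMap.comp_apply, Submodule.mkQ_apply, Submodule.mapQ_apply,
      LinearMap.add_apply, ← Submodule.Quotient.mk_add]
    congr 1
    exact Subtype.ext (mul_add _ _ _)
  map_smul' z c := by
    ext x
    simp only [LinearMap.comp_apply, Submodule.mkQ_apply, Submodule.mapQ_apply,
      LinearMap.smul_apply, ← Submodule.Quotient.mk_smul, RingHom.id_apply]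
    congr 1
    exact Subtype.ext (mul_smul_comm _ _ _)

theorem rmulQ_mk (c : B) (x : Bplus B) :
    rmulQ R c (R.carrier.mkQ x) = R.carrier.mkQ (rmul B c x) := rfl

theorem rmulQ_one : rmulQ R 1 = LinearMap.id := by
  ext x
  simp only [LinearMap.comp_apply, rmulQ_mk, LinearMap.id_apply]
  congr 1
  exact Subtype.ext (mul_one _)

theorem rmulQ_mul (b c : B) : rmulQ R (b * c) = rmulQ R c ∘ₗ rmulQ R b := by
  ext x
  simp only [LinearMap.comp_apply, rmulQ_mk]
  congr 1
  exact Subtype.ext (mul_assoc _ _ _).symm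

/-- The right action of `A ⊗ B` on `A ⊗ (B⁺ / R)`, `(a ⊗ v) (x ⊗ b) = a x ⊗ v b`. -/
def ract : A ⊗[ℂ] B →ₗ[ℂ] Module.End ℂ (A ⊗[ℂ] (Bplus B ⧸ R.carrier)) :=
  TensorProduct.homTensorHomMap (.id ℂ) A (Bplus B ⧸ R.carrier) A (Bplus B ⧸ R.carrier) ∘ₗ
    TensorProduct.map (LinearMap.mul ℂ A).flip (rmulQ R)

theorem ract_tmul (x a : A) (b : B) (v : Bplus B ⧸ R.carrier) :
    ract R (x ⊗ₜ b) (a ⊗ₜ v) = (a * x) ⊗ₜ rmulQ R b v := rfl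

theorem ract_one : ract R 1 = 1 := by
  ext a v
  simp [Algebra.TensorProduct.one_def, ract_tmul, rmulQ_one]

theorem ract_mul (s t : A ⊗[ℂ] B) : ract R (s * t) = ract R t * ract R s := by
  induction s with
  | zero => simp
  | add x y hx hy => simp [add_mul, mul_add, hx, hy]
  | tmul x b =>
    induction t with
    | zero => simp
    | add x y hx hy => simp [add_mul, mul_add, hx, hy]
    | tmul y c =>
      ext a v
      simp [ract_tmul, rmulQ_mul, mul_assoc]

/-- The right `B`-module structure `(a ⊗ v) c = a c₍₁₎ ⊗ v c₍₂₎` of `A ⊗ (B⁺ / R)`. -/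
abbrev rightModuleOf (hB : IsLeftCoideal B) :
    Module Bᵐᵒᵖ (A ⊗[ℂ] (Bplus B ⧸ R.carrier)) where
  smul c x := ract R (coactLin hB c.unop) x
  one_smul x := by
    change ract R (coactLin hB 1) x = x
    rw [coactLin_one, ract_one]; rfl
  mul_smul c c' x := by
    change ract R (coactLin hB (c'.unop * c.unop)) x = _
    rw [coactLin_mul, ract_mul]; rfl
  smul_zero c := map_zero (ract R (coactLin hB c.unop))
  smul_add c := map_add (ract R (coactLin hB c.unop))
  add_smul c c' x := by
    change ract R (coactLin hB (c.unop + c'.unop)) x = _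
    rw [map_add, map_add]; rfl
  zero_smul x := by
    change ract R (coactLin hB 0) x = 0
    rw [map_zero, map_zero]; rfl

/-- The linear map `b ↦ b₍₁₎ ⊗ p(b₍₂₎⁺)`, where `p : B⁺ → B⁺ / R` is the projection. -/
def dLin (hB : IsLeftCoideal B) : B →ₗ[ℂ] A ⊗[ℂ] (Bplus B ⧸ R.carrier) :=
  (R.carrier.mkQ ∘ₗ plus B).lTensor A ∘ₗ coactLin hB

theorem plus_mul (b c : B) :
    plus B (b * c) = rmul B c (plus B b) + counitB B b • plus B c := by
  apply Subtype.ext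
  simp [coe_rmul, coe_plus, counitB_mul, smul_sub, sub_mul, smul_smul]

theorem lTensor_plus_mul (s t : A ⊗[ℂ] B) :
    (R.carrier.mkQ ∘ₗ plus B).lTensor A (s * t) =
      (LinearMap.mulLeft ℂ (TensorProduct.rid ℂ A ((counitB B).lTensor A s))).rTensor _
        ((R.carrier.mkQ ∘ₗ plus B).lTensor A t) +
      ract R t ((R.carrier.mkQ ∘ₗ plus B).lTensor A s) := by
  induction s with
  | zero => simp [LinearMap.rTensor_zero]
  | add x y hx hy =>
    have h (a a' : A) : LinearMap.mulLeft ℂ (a + a') =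
        LinearMap.mulLeft ℂ a + LinearMap.mulLeft ℂ a' := by ext; simp [add_mul]
    simp only [add_mul, map_add, hx, hy, h, LinearMap.rTensor_add, LinearMap.add_apply]
    abel
  | tmul x b =>
    induction t with
    | zero => simp
    | add x y hx hy =>
      simp only [mul_add, map_add, hx, hy, LinearMap.add_apply]
      abel
    | tmul y c =>
      simp only [Algebra.TensorProduct.tmul_mul_tmul, LinearMap.lTensor_tmul,
        LinearMap.comp_apply, plus_mul, map_add, map_smul, TensorProduct.tmul_add, ract_tmul,
        rmulQ_mk, TensorProduct.rid_tmul, LinearMap.rTensor_tmul, LinearMap.mulLeft_apply,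
        TensorProduct.tmul_smul, smul_mul_assoc, TensorProduct.smul_tmul']
      abel

/-- The derivation `δ_R`, given by `a δ b = a b₍₁₎ ⊗ p(b₍₂₎⁺)`; the bimodule structure of
`A ⊗ (B⁺ / R)` is `b (a ⊗ v) c = b a c₍₁₎ ⊗ v c₍₂₎`. -/
def derivOf (hB : IsLeftCoideal B) : Deriv B :=
  letI := rightModuleOf R hB
  { M := A ⊗[ℂ] (Bplus B ⧸ R.carrier)
    rightTower := ⟨fun z c x => by
      change ract R (coactLin hB (z • c.unop)) x = z • ract R (coactLin hB c.unop) x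
      rw [map_smul, map_smul]; rfl⟩
    bimodule := ⟨fun b c x => by
      change b • ract R (coactLin hB c.unop) x = ract R (coactLin hB c.unop) (b • x)
      generalize coactLin hB c.unop = t
      induction x with
      | zero => simp
      | add x y hx hy => simp only [map_add, smul_add, hx, hy]
      | tmul a v =>
        induction t with
        | zero => simp
        | add x y hx hy => simp only [map_add, smul_add, LinearMap.add_apply, hx, hy]
        | tmul x c =>
          change (b • (a * x)) ⊗ₜ[ℂ] rmulQ R c v = ((b • a) * x) ⊗ₜ[ℂ] rmulQ R c v
          rw [smul_mul_assoc]⟩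
    d := dLin R hB
    leibniz := fun b c => by
      change (R.carrier.mkQ ∘ₗ plus B).lTensor A (coactLin hB (b * c)) =
        b • dLin R hB c + ract R (coactLin hB c) (dLin R hB b)
      rw [coactLin_mul, lTensor_plus_mul, counit_coactLin]
      congr 1 }

end Construction

variable (B : Subalgebra ℂ A)

/-- Derivations of `B`, where `δ` and `δ'` are considered identical if `δ ≤ δ'` and `δ' ≤ δ`. -/
abbrev DerivClass : Type (u + 1) := Antisymmetrization (Deriv B) (· ≤ ·)

variable {B}

/-- A derivation, up to identification, is equivariant. -/
def DerivClass.IsEquivariant (hB : IsLeftCoideal B) (δ : DerivClass B) : Prop :=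
  Quotient.liftOn δ (fun δ => δ.IsEquivariant hB) fun _ _ h =>
    propext ⟨fun h' => h'.congr h.1 h.2, fun h' => h'.congr h.2 h.1⟩

/-- The map `δ ↦ R_δ`. -/
def DerivClass.toRightIdeal (δ : DerivClass B) : RightIdeal B :=
  Quotient.liftOn δ Deriv.toRightIdeal fun _ _ h =>
    RightIdeal.ext (le_antisymm (Deriv.toRightIdeal_anti h.2) (Deriv.toRightIdeal_anti h.1))

/-- The map `R ↦ δ_R`. -/
def RightIdeal.toDeriv (hB : IsLeftCoideal B) (R : RightIdeal B) : DerivClass B :=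
  toAntisymmetrization (· ≤ ·) (derivOf R hB)

end Derivations

end QHS

end

/-! Write a formal one-form `∑ aᵢ δ bᵢ` as an element of the left `A`-comodule `B ⊗ B`. The
derivation `δ_R` is the comodule map from `B ⊗ B` to the cofree comodule `A ⊗ (B⁺ / R)` which lifts
`a ⊗ b ↦ ε(a) p(b⁺)`. Hence `δ_R` is always equivariant, `R_{δ_R} ⊆ R`, and `δ_{R_δ} ≤ δ` for every
equivariant `δ`.

The reverse inequalities come from the Maurer-Cartan form `ω(b) = S(b₍₁₎) ⊗ δ b₍₂₎ ∈ A ⊗_B M`, from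
which `δ` is recovered by `1 ⊗ δ b = b₍₁₎ ω(b₍₂₎)`. If `δ` is equivariant, then `ω` vanishes on
`R_δ`, so every form vanishing for `δ_{R_δ}` is zero in `A ⊗_B M`, and then zero in `M` by
faithfulness. Conversely, `ω(b) = 0` implies `b⁺ ∈ R_δ`: by flatness, the Maurer-Cartan form of the
universal map `b ↦ 1 ⊗ b` comes from `A ⊗_B K`, with `K` the kernel of `B ⊗ B → M`, and
`x ⊗ (a ⊗ c) ↦ ε(x) ε(a) c⁺` maps it to `b⁺`. For `δ = δ_R`, the form `ω(r)` is a linear function of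
the image of `r₍₁₎ ⊗ p(r₍₂₎⁺)` in `(A / B⁺A) ⊗ (B⁺ / R)`, which is zero for all `r ∈ R` exactly if
`R` is stable. -/

noncomputable section

namespace QHS

open TensorProduct

section LinearAlgebra

theorem exists_comp_eq_iff_ker_le {k X Y Z : Type*} [Ring k] [AddCommGroup X] [Module k X]
    [AddCommGroup Y] [Module k Y] [AddCommGroup Z] [Module k Z] {f : X →ₗ[k] Y}
    (hf : Function.Surjective f) (g : X →ₗ[k] Z) :
    (∃ φ : Y →ₗ[k] Z, φ ∘ₗ f = g) ↔ LinearMap.ker f ≤ LinearMap.ker g := by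
  constructor
  · rintro ⟨φ, rfl⟩
    exact LinearMap.ker_le_ker_comp f φ
  · intro h
    refine ⟨(LinearMap.ker f).liftQ g h ∘ₗ (f.quotKerEquivOfSurjective hf).symm, ?_⟩
    ext x
    have hx : (f.quotKerEquivOfSurjective hf).symm (f x) = (LinearMap.ker f).mkQ x :=
      (LinearEquiv.symm_apply_eq _).2 (f.quotKerEquivOfSurjective_apply_mk hf x).symm
    simp [hx]

theorem ker_lTensor_le_ker_lTensor {k X Y Z : Type*} [CommRing k] [AddCommGroup X] [Module k X]
    [AddCommGroup Y] [Module k Y] [AddCommGroup Z] [Module k Z] (P : Type*) [AddCommGroup P]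
    [Module k P] [Module.Flat k P] {f : X →ₗ[k] Y} {g : X →ₗ[k] Z}
    (h : LinearMap.ker f ≤ LinearMap.ker g) :
    LinearMap.ker (f.lTensor P) ≤ LinearMap.ker (g.lTensor P) := by
  intro z hz
  obtain ⟨w, rfl⟩ := (Module.Flat.lTensor_exact P f.exact_subtype_ker_map z).1 hz
  have hg : g ∘ₗ (LinearMap.ker f).subtype = 0 := LinearMap.ext fun x => h x.2
  rw [LinearMap.mem_ker, ← LinearMap.lTensor_comp_apply, hg, LinearMap.lTensor_zero,
    LinearMap.zero_apply]

theorem rTensor_lTensor_apply {k X Y P Q : Type*} [CommSemiring k] [AddCommMonoid X] [Module k X]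
    [AddCommMonoid Y] [Module k Y] [AddCommMonoid P] [Module k P] [AddCommMonoid Q] [Module k Q]
    (f : P →ₗ[k] Q) (g : X →ₗ[k] Y) (z : P ⊗[k] X) :
    f.rTensor Y (g.lTensor P z) = g.lTensor Q (f.rTensor X z) := by
  rw [← LinearMap.comp_apply, LinearMap.rTensor_comp_lTensor, ← LinearMap.lTensor_comp_rTensor,
    LinearMap.comp_apply]

variable {k S V M : Type*} [CommSemiring k] [Semiring S] [Algebra k S] [AddCommMonoid V]
  [Module k V] [AddCommMonoid M] [Module k M] [Module S M] [IsScalarTower k S M]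

/-- The `S`-linear extension `s ⊗ v ↦ s • g v` of a `k`-linear map `g : V → M`; unlike
`LinearMap.liftBaseChange`, it allows `S` to be noncommutative. -/
def smulLift (g : V →ₗ[k] M) : S ⊗[k] V →ₗ[S] M :=
  AlgebraTensorModule.lift (LinearMap.toSpanSingleton S (V →ₗ[k] M) g)

theorem smulLift_lTensor {U : Type*} [AddCommMonoid U] [Module k U] (g : V →ₗ[k] M)
    (f : U →ₗ[k] V) (z : S ⊗[k] U) : smulLift g (f.lTensor S z) = smulLift (g ∘ₗ f) z := by
  have h : (smulLift (S := S) g).restrictScalars k ∘ₗ f.lTensor S =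
      (smulLift (g ∘ₗ f)).restrictScalars k := TensorProduct.ext' fun _ _ => rfl
  exact LinearMap.congr_fun h z

end LinearAlgebra

section Coaction

variable {k C X V : Type*} [CommSemiring k] [AddCommMonoid C] [Module k C] [Coalgebra k C]
  [AddCommMonoid X] [Module k X] [AddCommMonoid V] [Module k V]

/-- A linear map `ρ : X → C ⊗ X` which makes `X` a left comodule over the coalgebra `C`. -/
structure IsCoaction (ρ : X →ₗ[k] C ⊗[k] X) : Prop where
  coassoc (x : X) :
    TensorProduct.assoc k C C X (Coalgebra.comul.rTensor X (ρ x)) = ρ.lTensor C (ρ x)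
  counit (x : X) : Coalgebra.counit.rTensor X (ρ x) = (1 : k) ⊗ₜ[k] x

/-- The lift `x ↦ x₍₋₁₎ ⊗ π(x₍₀₎)` of a linear map `π : X → V` on a comodule `X` to a comodule map
from `X` to the cofree comodule `C ⊗ V`. -/
def cofreeLift (ρ : X →ₗ[k] C ⊗[k] X) (π : X →ₗ[k] V) : X →ₗ[k] C ⊗[k] V :=
  π.lTensor C ∘ₗ ρ

theorem assoc_comul_lTensor (π : X →ₗ[k] V) (z : C ⊗[k] X) :
    TensorProduct.assoc k C C V (Coalgebra.comul.rTensor V (π.lTensor C z)) =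
      (π.lTensor C).lTensor C (TensorProduct.assoc k C C X (Coalgebra.comul.rTensor X z)) := by
  rw [rTensor_lTensor_apply, LinearMap.lTensor_tensor]
  simp

variable {ρ : X →ₗ[k] C ⊗[k] X} (hρ : IsCoaction ρ) (π : X →ₗ[k] V)
include hρ

theorem IsCoaction.counit_cofreeLift (x : X) :
    Coalgebra.counit.rTensor V (cofreeLift ρ π x) = (1 : k) ⊗ₜ[k] π x := by
  rw [cofreeLift, LinearMap.comp_apply, rTensor_lTensor_apply, hρ.counit, LinearMap.lTensor_tmul]

theorem IsCoaction.assoc_comul_cofreeLift (x : X) :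
    TensorProduct.assoc k C C V (Coalgebra.comul.rTensor V (cofreeLift ρ π x)) =
      (cofreeLift ρ π).lTensor C (ρ x) := by
  rw [cofreeLift, LinearMap.comp_apply, assoc_comul_lTensor, hρ.coassoc,
    ← LinearMap.lTensor_comp_apply]

theorem IsCoaction.lTensor_cofreeLift_eq_zero {x : X} (hx : cofreeLift ρ π x = 0) :
    (cofreeLift ρ π).lTensor C (ρ x) = 0 := by
  rw [← hρ.assoc_comul_cofreeLift, hx, map_zero, map_zero]

end Coaction

section DiagonalCoaction

variable {k H : Type*} [CommSemiring k] [Semiring H]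

section Algebra

variable [Algebra k H] (X Y : Type*) [AddCommMonoid X] [Module k X] [AddCommMonoid Y] [Module k Y]

/-- The linear map `(H ⊗ X) ⊗ (H ⊗ Y) → H ⊗ (X ⊗ Y)`, `(g ⊗ x) ⊗ (h ⊗ y) ↦ g h ⊗ (x ⊗ y)`. -/
def diagMul : (H ⊗[k] X) ⊗[k] (H ⊗[k] Y) →ₗ[k] H ⊗[k] (X ⊗[k] Y) :=
  (LinearMap.mul' k H).rTensor (X ⊗[k] Y) ∘ₗ (tensorTensorTensorComm k H X H Y).toLinearMap

variable {X Y}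

@[simp]
theorem diagMul_tmul (g h : H) (x : X) (y : Y) :
    diagMul X Y ((g ⊗ₜ[k] x) ⊗ₜ[k] (h ⊗ₜ[k] y)) = (g * h) ⊗ₜ[k] (x ⊗ₜ[k] y) := rfl

/-- The diagonal coaction `x ⊗ y ↦ x₍₋₁₎ y₍₋₁₎ ⊗ (x₍₀₎ ⊗ y₍₀₎)` on a tensor product. -/
def diagCoaction (ρ : X →ₗ[k] H ⊗[k] X) (σ : Y →ₗ[k] H ⊗[k] Y) :
    X ⊗[k] Y →ₗ[k] H ⊗[k] (X ⊗[k] Y) :=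
  diagMul X Y ∘ₗ TensorProduct.map ρ σ

theorem diagCoaction_tmul (ρ : X →ₗ[k] H ⊗[k] X) (σ : Y →ₗ[k] H ⊗[k] Y) (x : X) (y : Y) :
    diagCoaction ρ σ (x ⊗ₜ[k] y) = diagMul X Y (ρ x ⊗ₜ[k] σ y) := rfl

theorem lTensor_diagCoaction_diagMul (ρ : X →ₗ[k] H ⊗[k] X) (σ : Y →ₗ[k] H ⊗[k] Y) (s : H ⊗[k] X)
    (t : H ⊗[k] Y) :
    (diagCoaction ρ σ).lTensor H (diagMul X Y (s ⊗ₜ[k] t)) =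
      (diagMul X Y).lTensor H
        (diagMul (H ⊗[k] X) (H ⊗[k] Y) (ρ.lTensor H s ⊗ₜ[k] σ.lTensor H t)) := by
  have h : (diagCoaction ρ σ).lTensor H ∘ₗ diagMul X Y = (diagMul X Y).lTensor H ∘ₗ
      diagMul (H ⊗[k] X) (H ⊗[k] Y) ∘ₗ TensorProduct.map (ρ.lTensor H) (σ.lTensor H) := by
    ext; rfl
  exact LinearMap.congr_fun h (s ⊗ₜ[k] t)

theorem assoc_mul_tmul (p q : H ⊗[k] H) (x : X) (y : Y) :
    TensorProduct.assoc k H H (X ⊗[k] Y) ((p * q) ⊗ₜ[k] (x ⊗ₜ[k] y)) =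
      (diagMul X Y).lTensor H (diagMul (H ⊗[k] X) (H ⊗[k] Y)
        (TensorProduct.assoc k H H X (p ⊗ₜ[k] x) ⊗ₜ[k]
          TensorProduct.assoc k H H Y (q ⊗ₜ[k] y))) := by
  induction p with
  | zero => simp
  | add p p' hp hp' => simp only [add_mul, add_tmul, map_add, hp, hp']
  | tmul a b =>
    induction q with
    | zero => simp
    | add q q' hq hq' => simp only [mul_add, add_tmul, tmul_add, map_add, hq, hq']
    | tmul c d => simp

end Algebra

variable [Bialgebra k H] {X Y : Type*} [AddCommMonoid X] [Module k X] [AddCommMonoid Y]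
  [Module k Y]

theorem assoc_comul_diagMul (s : H ⊗[k] X) (t : H ⊗[k] Y) :
    TensorProduct.assoc k H H (X ⊗[k] Y)
        (Coalgebra.comul.rTensor (X ⊗[k] Y) (diagMul X Y (s ⊗ₜ[k] t))) =
      (diagMul X Y).lTensor H (diagMul (H ⊗[k] X) (H ⊗[k] Y)
        (TensorProduct.assoc k H H X (Coalgebra.comul.rTensor X s) ⊗ₜ[k]
          TensorProduct.assoc k H H Y (Coalgebra.comul.rTensor Y t))) := by
  induction s with
  | zero => simp
  | add s s' hs hs' => simp only [add_tmul, map_add, hs, hs']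
  | tmul g x =>
    induction t with
    | zero => simp
    | add t t' ht ht' => simp only [tmul_add, map_add, ht, ht']
    | tmul h y =>
      rw [diagMul_tmul, LinearMap.rTensor_tmul, Bialgebra.comul_mul, assoc_mul_tmul]
      rfl

theorem counit_diagMul (s : H ⊗[k] X) (t : H ⊗[k] Y) :
    Coalgebra.counit.rTensor (X ⊗[k] Y) (diagMul X Y (s ⊗ₜ[k] t)) =
      diagMul X Y (Coalgebra.counit.rTensor X s ⊗ₜ[k] Coalgebra.counit.rTensor Y t) := by
  have h : Coalgebra.counit.rTensor (X ⊗[k] Y) ∘ₗ diagMul (k := k) (H := H) X Y =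
      diagMul X Y ∘ₗ TensorProduct.map (Coalgebra.counit.rTensor X)
        (Coalgebra.counit.rTensor Y) := by
    ext; simp
  exact LinearMap.congr_fun h (s ⊗ₜ[k] t)

theorem IsCoaction.diagCoaction {ρ : X →ₗ[k] H ⊗[k] X} {σ : Y →ₗ[k] H ⊗[k] Y}
    (hρ : IsCoaction ρ) (hσ : IsCoaction σ) : IsCoaction (diagCoaction ρ σ) where
  coassoc z := by
    induction z with
    | zero => simp
    | add z z' hz hz' => simp only [map_add, hz, hz']
    | tmul x y =>
      rw [diagCoaction_tmul, assoc_comul_diagMul, hρ.coassoc, hσ.coassoc,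
        lTensor_diagCoaction_diagMul]
  counit z := by
    induction z with
    | zero => simp
    | add z z' hz hz' => simp only [map_add, tmul_add, hz, hz']
    | tmul x y =>
      rw [diagCoaction_tmul, counit_diagMul, hρ.counit, hσ.counit, diagMul_tmul, mul_one]

end DiagonalCoaction

section TensorB

variable {A : Type u} [Ring A] [Algebra ℂ A] {B : Subalgebra ℂ A}
  {M : Type u} [AddCommGroup M] [Module ℂ M] [Module B M]

theorem mkQ_mul_tmul (a : A) (b : B) (m : M) :
    (balanced B M).mkQ ((a * b) ⊗ₜ[ℂ] m) = (balanced B M).mkQ (a ⊗ₜ[ℂ] (b • m)) :=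
  (Submodule.Quotient.eq _).2 (Submodule.subset_span ⟨a, b, m, rfl⟩)

theorem tensorB_hom_ext {V : Type*} [AddCommGroup V] [Module ℂ V] {f g : TensorB B M →ₗ[ℂ] V}
    (h : ∀ a m, f ((balanced B M).mkQ (a ⊗ₜ m)) = g ((balanced B M).mkQ (a ⊗ₜ m))) : f = g :=
  Submodule.linearMap_qext _ (TensorProduct.ext' h)

instance : SMul A (TensorB B M) where
  smul a := (balanced B M).mapQ (balanced B M) (Algebra.lsmul ℂ ℂ (A ⊗[ℂ] M) a) <|
    Submodule.span_le.2 <| by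
      rintro _ ⟨a', b, m, rfl⟩
      exact Submodule.subset_span ⟨a * a', b, m, by simp [smul_sub, smul_tmul', mul_assoc]⟩

/-- The left `A`-module structure of `A ⊗_B M`. -/
instance : Module A (TensorB B M) :=
  (balanced B M).mkQ_surjective.module A (balanced B M).mkQ.toAddMonoidHom fun _ _ => rfl

theorem smul_mkQ (a : A) (z : A ⊗[ℂ] M) :
    a • (balanced B M).mkQ z = (balanced B M).mkQ (a • z) := rfl

instance : IsScalarTower ℂ A (TensorB B M) where
  smul_assoc c a z := by
    obtain ⟨z, rfl⟩ := (balanced B M).mkQ_surjective z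
    rw [smul_mkQ, smul_mkQ, smul_assoc, map_smul]

variable [IsScalarTower ℂ B M]

theorem IsFaithfullyFlatRight.exact_tensorBMap_ker_subtype (hflat : IsFaithfullyFlatRight B)
    {N : Type u} [AddCommGroup N] [Module ℂ N] [Module B N] [IsScalarTower ℂ B N]
    (f : M →ₗ[B] N) :
    Function.Exact (tensorBMap (LinearMap.ker f).subtype) (tensorBMap f) :=
  (hflat _ _ _ _ _).1 f.exact_subtype_ker_map

theorem IsFaithfullyFlatRight.eq_zero_of_mkQ_tmul_eq_zero (hflat : IsFaithfullyFlatRight B) {m : M}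
    (hm : (balanced B M).mkQ ((1 : A) ⊗ₜ[ℂ] m) = 0) : m = 0 := by
  have tensorBMap_eq_zero : tensorBMap (LinearMap.toSpanSingleton B M m) = 0 := by
    refine tensorB_hom_ext fun a b => ?_
    calc (balanced B M).mkQ (a ⊗ₜ[ℂ] (b • m))
      _ = (a * b) • (balanced B M).mkQ ((1 : A) ⊗ₜ[ℂ] m) := by
        rw [← mkQ_mul_tmul, smul_mkQ, smul_tmul', smul_eq_mul, mul_one]
      _ = 0 := by rw [hm, smul_zero]
  have tensorBMap_id : tensorBMap (LinearMap.id : B →ₗ[B] B) = LinearMap.id :=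
    tensorB_hom_ext fun a b => rfl
  have exact : Function.Exact (LinearMap.id : B →ₗ[B] B) (LinearMap.toSpanSingleton B M m) := by
    rw [hflat, tensorBMap_eq_zero, tensorBMap_id]
    exact fun z => ⟨fun _ => ⟨z, rfl⟩, fun _ => rfl⟩
  simpa using (exact 1).2 ⟨1, rfl⟩

end TensorB

variable {A : Type u} [Ring A] [HopfAlgebra ℂ A] {B : Subalgebra ℂ A}

section LeftCoideal

variable (hB : IsLeftCoideal B)

theorem isCoaction_coactLin : IsCoaction (coactLin hB) where
  coassoc b := by
    apply Module.Flat.lTensor_preserves_injective_linearMap (M := A) _ (lTensor_val_injective B)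
    have h : Coalgebra.comul ∘ₗ B.val.toLinearMap = B.val.toLinearMap.lTensor A ∘ₗ coactLin hB :=
      LinearMap.ext fun b => (lTensor_coactLin hB b).symm
    rw [← assoc_comul_lTensor, lTensor_coactLin, Coalgebra.coassoc_apply, ← lTensor_coactLin hB,
      ← LinearMap.lTensor_comp_apply, ← LinearMap.lTensor_comp_apply, h]
  counit b := by
    apply Module.Flat.lTensor_preserves_injective_linearMap (M := ℂ) B.val.toLinearMap
      Subtype.val_injective
    rw [← rTensor_lTensor_apply, lTensor_coactLin, Coalgebra.rTensor_counit_comul]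
    rfl

/-- The diagonal coaction of `A` on `B ⊗ B`, the space of formal one-forms `∑ aᵢ δ bᵢ`. -/
def formCoaction : B ⊗[ℂ] B →ₗ[ℂ] A ⊗[ℂ] (B ⊗[ℂ] B) :=
  diagCoaction (coactLin hB) (coactLin hB)

theorem isCoaction_formCoaction : IsCoaction (formCoaction hB) :=
  (isCoaction_coactLin hB).diagCoaction (isCoaction_coactLin hB)

theorem lTensor_counitPlus_diagMul (s t : A ⊗[ℂ] B) :
    (Deriv.counitPlus B).lTensor A (diagMul B B (s ⊗ₜ[ℂ] t)) =
      TensorProduct.rid ℂ A ((counitB B).lTensor A s) • (plus B).lTensor A t := by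
  induction s with
  | zero => simp
  | add s s' hs hs' => simp only [add_tmul, map_add, add_smul, hs, hs']
  | tmul x a =>
    induction t with
    | zero => simp
    | add t t' ht ht' => simp only [tmul_add, map_add, smul_add, ht, ht']
    | tmul y b => simp [Deriv.counitPlus_tmul, smul_tmul']

theorem cofreeLift_counitPlus_tmul (a b : B) :
    cofreeLift (formCoaction hB) (Deriv.counitPlus B) (a ⊗ₜ b) =
      (a : A) • cofreeLift (coactLin hB) (plus B) b := by
  rw [← counit_coactLin hB a]
  exact lTensor_counitPlus_diagMul _ _

end LeftCoideal

namespace Deriv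

variable {δ δ' : Deriv B}

theorem le_iff_ker_formLin_le :
    δ ≤ δ' ↔ LinearMap.ker δ'.formLin ≤ LinearMap.ker δ.formLin := by
  rw [← exists_comp_eq_iff_ker_le δ'.formLin_surjective]
  exact exists_congr fun φ =>
    ⟨fun h => TensorProduct.ext' h, fun h a b => LinearMap.congr_fun h (a ⊗ₜ b)⟩

theorem isEquivariant_iff_ker_formLin_le {hB : IsLeftCoideal B} :
    δ.IsEquivariant hB ↔
      LinearMap.ker δ.formLin ≤ LinearMap.ker (cofreeLift (formCoaction hB) δ.formLin) := by
  have diagForm_eq (a b : B) : δ.diagForm (coactLin hB a ⊗ₜ coactLin hB b) =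
      cofreeLift (formCoaction hB) δ.formLin (a ⊗ₜ b) := by
    have h : δ.diagForm = δ.formLin.lTensor A ∘ₗ diagMul B B := by ext; rfl
    exact LinearMap.congr_fun h _
  rw [← exists_comp_eq_iff_ker_le δ.formLin_surjective]
  refine exists_congr fun Φ => ⟨fun h => TensorProduct.ext' fun a b => ?_, fun h a b => ?_⟩
  · exact (h a b).trans (diagForm_eq a b)
  · rw [diagForm_eq, ← h]; rfl

theorem map_one (δ : Deriv B) : δ.d 1 = 0 := by
  simpa using δ.leibniz 1 1

theorem map_plus (δ : Deriv B) (b : B) : δ.d (plus B b) = δ.d b := by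
  rw [coe_plus, map_sub, map_smul, δ.map_one, smul_zero, sub_zero]

theorem coe_formLin (t : B ⊗[ℂ] B) : (δ.formLin t : δ.M) = smulLift (S := B) δ.d t := by
  have h : δ.Gamma.subtype ∘ₗ δ.formLin = (smulLift (S := B) δ.d).restrictScalars ℂ := by ext; rfl
  exact LinearMap.congr_fun h t

end Deriv

section DerivOf

variable (hB : IsLeftCoideal B) (R : RightIdeal B)

theorem smulLift_dLin (t : B ⊗[ℂ] B) :
    smulLift (S := B) (dLin R hB) t =
      cofreeLift (formCoaction hB) (R.carrier.mkQ ∘ₗ Deriv.counitPlus B) t := by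
  have lTensor_mkQ_smul (a : A) (z : A ⊗[ℂ] Bplus B) :
      R.carrier.mkQ.lTensor A (a • z) = a • R.carrier.mkQ.lTensor A z :=
    (AlgebraTensorModule.lTensor A A R.carrier.mkQ).map_smul a z
  have h : (smulLift (S := B) (dLin R hB)).restrictScalars ℂ =
      cofreeLift (formCoaction hB) (R.carrier.mkQ ∘ₗ Deriv.counitPlus B) := by
    refine TensorProduct.ext' fun a b => ?_
    calc (a : A) • dLin R hB b
      _ = R.carrier.mkQ.lTensor A ((a : A) • cofreeLift (coactLin hB) (plus B) b) := by
        rw [lTensor_mkQ_smul, dLin, LinearMap.lTensor_comp]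
        rfl
      _ = _ := by
        rw [← cofreeLift_counitPlus_tmul, cofreeLift, cofreeLift, LinearMap.lTensor_comp]
        rfl
  exact LinearMap.congr_fun h t

theorem ker_formLin_derivOf :
    LinearMap.ker (derivOf R hB).formLin =
      LinearMap.ker (cofreeLift (formCoaction hB) (R.carrier.mkQ ∘ₗ Deriv.counitPlus B)) := by
  ext t
  rw [LinearMap.mem_ker, LinearMap.mem_ker, ← Submodule.coe_eq_zero, Deriv.coe_formLin,
    ← smulLift_dLin]
  rfl

theorem isEquivariant_derivOf : (derivOf R hB).IsEquivariant hB := by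
  rw [Deriv.isEquivariant_iff_ker_formLin_le]
  intro t ht
  refine ker_lTensor_le_ker_lTensor A (ker_formLin_derivOf hB R).ge ?_
  rw [ker_formLin_derivOf] at ht
  exact (isCoaction_formCoaction hB).lTensor_cofreeLift_eq_zero _ ht

theorem toRightIdeal_derivOf_le : (derivOf R hB).toRightIdeal.carrier ≤ R.carrier := by
  rintro _ ⟨t, ht, rfl⟩
  rw [SetLike.mem_coe, ker_formLin_derivOf] at ht
  have h := (isCoaction_formCoaction hB).counit_cofreeLift (R.carrier.mkQ ∘ₗ Deriv.counitPlus B) t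
  rw [LinearMap.mem_ker.1 ht, map_zero] at h
  rw [← R.carrier.ker_mkQ, LinearMap.mem_ker]
  simpa using (congrArg (TensorProduct.lid ℂ _) h).symm

variable {hB} in
theorem Deriv.IsEquivariant.derivOf_toRightIdeal_le {δ : Deriv B} (hδ : δ.IsEquivariant hB) :
    derivOf δ.toRightIdeal hB ≤ δ := by
  rw [Deriv.le_iff_ker_formLin_le, ker_formLin_derivOf]
  have h : LinearMap.ker δ.formLin ≤
      LinearMap.ker (δ.toRightIdeal.carrier.mkQ ∘ₗ Deriv.counitPlus B) := fun t ht =>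
    (Submodule.Quotient.mk_eq_zero _).2 ⟨t, ht, rfl⟩
  exact fun t ht =>
    ker_lTensor_le_ker_lTensor A h (Deriv.isEquivariant_iff_ker_formLin_le.1 hδ ht)

end DerivOf

section Stability

variable {R : RightIdeal B}

theorem mkQ_val_mul (b : B) (a : A) :
    (BplusA B).mkQ (b * a) = counitB B b • (BplusA B).mkQ a := by
  have h : (plus B b : A) * a ∈ BplusA B := Submodule.subset_span ⟨_, (plus B b).2, a, rfl⟩
  rw [← map_smul, ← sub_eq_zero, ← map_sub, Submodule.mkQ_apply, Submodule.Quotient.mk_eq_zero]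
  simpa [coe_plus, sub_mul] using h

theorem mkQ_rTensor_val_smul {V : Type*} [AddCommGroup V] [Module ℂ V] (b : B) (z : A ⊗[ℂ] V) :
    (BplusA B).mkQ.rTensor V ((b : A) • z) = counitB B b • (BplusA B).mkQ.rTensor V z := by
  induction z with
  | zero => simp
  | add z z' hz hz' => simp only [smul_add, map_add, hz, hz']
  | tmul a v =>
    simp only [smul_tmul', smul_eq_mul, LinearMap.rTensor_tmul, mkQ_val_mul]

theorem comulBar_coe (hB : IsLeftCoideal B) (r : Bplus B) :
    comulBar B (r : B) = (B.val.toLinearMap ∘ₗ (Bplus B).subtype).lTensor _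
      ((plus B).lTensor _ ((BplusA B).mkQ.rTensor B (coactLin hB r))) := by
  set z := (BplusA B).mkQ.rTensor B (coactLin hB r) with hz
  have mkQ_coe : (BplusA B).mkQ (r : B) = 0 := by
    simpa [show counitB B (r : B) = 0 from r.2] using mkQ_val_mul (r : B) 1
  have counit_z : (counitB B).lTensor _ z = 0 := by
    have h : (counitB B).lTensor A (coactLin hB r) = ((r : B) : A) ⊗ₜ[ℂ] (1 : ℂ) := by
      rw [← counit_coactLin hB, ← TensorProduct.rid_symm_apply, LinearEquiv.symm_apply_apply]
    rw [hz, ← rTensor_lTensor_apply, h, LinearMap.rTensor_tmul, mkQ_coe, zero_tmul]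
  have subtype_comp_plus : (Bplus B).subtype ∘ₗ plus B =
      LinearMap.id - LinearMap.toSpanSingleton ℂ B 1 ∘ₗ counitB B := rfl
  rw [← LinearMap.lTensor_comp_apply, LinearMap.comp_assoc, subtype_comp_plus,
    LinearMap.lTensor_comp_apply, LinearMap.lTensor_sub, LinearMap.sub_apply,
    LinearMap.lTensor_comp_apply, counit_z, map_zero, sub_zero, LinearMap.lTensor_id_apply, hz,
    ← rTensor_lTensor_apply, lTensor_coactLin]
  rfl

theorem isStable_iff_mkQ_rTensor_dLin_eq_zero (hB : IsLeftCoideal B) :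
    R.IsStable ↔ ∀ r ∈ R.carrier, (BplusA B).mkQ.rTensor _ (dLin R hB r) = 0 := by
  have val_injective : Function.Injective
      ((B.val.toLinearMap ∘ₗ (Bplus B).subtype).lTensor (A ⧸ BplusA B)) :=
    Module.Flat.lTensor_preserves_injective_linearMap _
      (Subtype.val_injective.comp Subtype.val_injective)
  have exact : Function.Exact (R.carrier.subtype.lTensor (A ⧸ BplusA B))
      (R.carrier.mkQ.lTensor (A ⧸ BplusA B)) :=
    lTensor_exact _ (LinearMap.exact_subtype_mkQ _) R.carrier.mkQ_surjective
  rw [RightIdeal.IsStable, SetLike.forall]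
  refine forall₂_congr fun r hr => ?_
  rw [dLin, LinearMap.comp_apply, rTensor_lTensor_apply, LinearMap.lTensor_comp_apply, exact]
  change comulBar B (r : B) ∈ _ ↔ _
  rw [comulBar_coe hB, RightIdeal.incl, ← LinearMap.comp_assoc, LinearMap.lTensor_comp]
  simp only [LinearMap.mem_range, Set.mem_range, LinearMap.comp_apply, val_injective.eq_iff]

theorem isStable_of_le_toRightIdeal_derivOf (hB : IsLeftCoideal B)
    (h : R.carrier ≤ (derivOf R hB).toRightIdeal.carrier) : R.IsStable := by
  have mkQ_dLin_counitPlus : (BplusA B).mkQ.rTensor _ ∘ₗ dLin R hB ∘ₗ (Bplus B).subtype ∘ₗ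
      Deriv.counitPlus B = (BplusA B).mkQ.rTensor _ ∘ₗ
        (smulLift (S := B) (dLin R hB)).restrictScalars ℂ := by
    refine TensorProduct.ext' fun a b => ?_
    calc (BplusA B).mkQ.rTensor _ (dLin R hB (counitB B a • (plus B b : B)))
      _ = counitB B a • (BplusA B).mkQ.rTensor _ (dLin R hB b) := by
        rw [map_smul, map_smul]
        exact congrArg (counitB B a • (BplusA B).mkQ.rTensor _ ·) ((derivOf R hB).map_plus b)
      _ = (BplusA B).mkQ.rTensor _ ((a : A) • dLin R hB b) := (mkQ_rTensor_val_smul a _).symm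
  rw [isStable_iff_mkQ_rTensor_dLin_eq_zero hB]
  intro r hr
  obtain ⟨t, ht, rfl⟩ := h hr
  have ht' : smulLift (S := B) (dLin R hB) t = 0 := by
    rw [smulLift_dLin]
    exact (ker_formLin_derivOf hB R).le ht
  refine (LinearMap.congr_fun mkQ_dLin_counitPlus t).trans ?_
  rw [LinearMap.comp_apply, LinearMap.restrictScalars_apply, ht', map_zero]

theorem Deriv.IsEquivariant.isStable_toRightIdeal {hB : IsLeftCoideal B} {δ : Deriv B}
    (hδ : δ.IsEquivariant hB) : δ.toRightIdeal.IsStable :=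
  isStable_of_le_toRightIdeal_derivOf hB (Deriv.toRightIdeal_anti hδ.derivOf_toRightIdeal_le)

end Stability

section MaurerCartan

variable {M : Type u} [AddCommGroup M] [Module ℂ M] [Module B M]

variable (B M) in
/-- The linear map `A ⊗ M → A ⊗_B M`, `a ⊗ m ↦ S(a) ⊗ m`. -/
def antipodeTwist : A ⊗[ℂ] M →ₗ[ℂ] TensorB B M :=
  (balanced B M).mkQ ∘ₗ (HopfAlgebra.antipode ℂ).rTensor M

theorem antipodeTwist_tmul (a : A) (m : M) :
    antipodeTwist B M (a ⊗ₜ m) = (balanced B M).mkQ (HopfAlgebra.antipode ℂ a ⊗ₜ m) := rfl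

/-- The Maurer-Cartan form `b ↦ S(b₍₁₎) ⊗ d b₍₂₎` of a linear map `d : B → M`, with values in
`A ⊗_B M`. -/
def maurerCartan (hB : IsLeftCoideal B) (d : B →ₗ[ℂ] M) : B →ₗ[ℂ] TensorB B M :=
  antipodeTwist B M ∘ₗ cofreeLift (coactLin hB) d

variable (hB : IsLeftCoideal B)

theorem smulLift_antipodeTwist_assoc_comul (z : A ⊗[ℂ] M) :
    smulLift (S := A) (antipodeTwist B M)
        (TensorProduct.assoc ℂ A A M (Coalgebra.comul.rTensor M z)) =
      (balanced B M).mkQ ((1 : A) ⊗ₜ TensorProduct.lid ℂ M (Coalgebra.counit.rTensor M z)) := by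
  have contract (p : A ⊗[ℂ] A) (m : M) :
      smulLift (S := A) (antipodeTwist B M) (TensorProduct.assoc ℂ A A M (p ⊗ₜ m)) =
        (balanced B M).mkQ
          (LinearMap.mul' ℂ A ((HopfAlgebra.antipode ℂ).lTensor A p) ⊗ₜ m) := by
    induction p with
    | zero => simp
    | add p q hp hq => simp only [add_tmul, map_add, hp, hq]
    | tmul a c => rfl
  induction z with
  | zero => simp
  | add z w hz hw => simp only [map_add, tmul_add, hz, hw]
  | tmul a m =>
    rw [LinearMap.rTensor_tmul, contract, HopfAlgebra.mul_antipode_lTensor_comul_apply,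
      LinearMap.rTensor_tmul, TensorProduct.lid_tmul, Algebra.algebraMap_eq_smul_one, smul_tmul]

theorem smulLift_maurerCartan_coactLin (d : B →ₗ[ℂ] M) (b : B) :
    smulLift (S := A) (maurerCartan hB d) (coactLin hB b) =
      (balanced B M).mkQ ((1 : A) ⊗ₜ d b) := by
  rw [maurerCartan, ← smulLift_lTensor, ← (isCoaction_coactLin hB).assoc_comul_cofreeLift,
    smulLift_antipodeTwist_assoc_comul, (isCoaction_coactLin hB).counit_cofreeLift,
    TensorProduct.lid_tmul, one_smul]

theorem maurerCartan_plus (δ : Deriv B) (b : B) :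
    maurerCartan hB δ.d (plus B b) = maurerCartan hB δ.d b := by
  have maurerCartan_one : maurerCartan hB δ.d 1 = 0 := by
    rw [maurerCartan, LinearMap.comp_apply, cofreeLift, LinearMap.comp_apply, coactLin_one,
      Algebra.TensorProduct.one_def, LinearMap.lTensor_tmul, δ.map_one, tmul_zero, map_zero]
  rw [coe_plus, map_sub, map_smul, maurerCartan_one, smul_zero, sub_zero]

theorem smulLift_maurerCartan_cofreeLift_counitPlus (δ : Deriv B) (t : B ⊗[ℂ] B) :
    smulLift (S := A) (maurerCartan hB δ.d ∘ₗ (Bplus B).subtype)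
        (cofreeLift (formCoaction hB) (Deriv.counitPlus B) t) =
      (balanced B δ.M).mkQ ((1 : A) ⊗ₜ (δ.formLin t : δ.M)) := by
  have comp_plus : (maurerCartan hB δ.d ∘ₗ (Bplus B).subtype) ∘ₗ plus B = maurerCartan hB δ.d :=
    LinearMap.ext (maurerCartan_plus hB δ)
  induction t with
  | zero => simp
  | add t t' ht ht' => simp only [map_add, Submodule.coe_add, tmul_add, ht, ht']
  | tmul a b =>
    rw [cofreeLift_counitPlus_tmul, map_smul, cofreeLift, LinearMap.comp_apply, smulLift_lTensor,
      comp_plus, smulLift_maurerCartan_coactLin, smul_mkQ, smul_tmul', smul_eq_mul, mul_one,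
      ← one_mul (a : A), mkQ_mul_tmul]
    rfl

variable [IsScalarTower ℂ B M] {X : Type*} [AddCommGroup X] [Module ℂ X]

theorem antipodeTwist_smulLift_diagMul_tmul (g : X →ₗ[ℂ] M) (s : A ⊗[ℂ] B) (y : A) (x : X) :
    antipodeTwist B M (((smulLift (S := B) g).restrictScalars ℂ).lTensor A
        (diagMul B X (s ⊗ₜ (y ⊗ₜ x)))) =
      (balanced B M).mkQ ((HopfAlgebra.antipode ℂ y *
        LinearMap.mul' ℂ A ((HopfAlgebra.antipode ℂ).rTensor A (B.val.toLinearMap.lTensor A s)))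
          ⊗ₜ g x) := by
  induction s with
  | zero => simp
  | add s s' hs hs' => simp only [add_tmul, map_add, mul_add, hs, hs']
  | tmul a c =>
    calc (balanced B M).mkQ (HopfAlgebra.antipode ℂ (a * y) ⊗ₜ (c • g x))
      _ = (balanced B M).mkQ
            ((HopfAlgebra.antipode ℂ y * (HopfAlgebra.antipode ℂ a * c)) ⊗ₜ g x) := by
        rw [← mkQ_mul_tmul, HopfAlgebra.antipode_mul_antidistrib, mul_assoc]

-- This is the identity `S(b₍₁₎ a) b₍₂₎ = ε(b) S(a)`, applied in the first tensor factor.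
theorem antipodeTwist_smulLift_diagMul_coactLin (g : X →ₗ[ℂ] M) (b : B) (z : A ⊗[ℂ] X) :
    antipodeTwist B M (((smulLift (S := B) g).restrictScalars ℂ).lTensor A
        (diagMul B X (coactLin hB b ⊗ₜ z))) =
      counitB B b • antipodeTwist B M (g.lTensor A z) := by
  induction z with
  | zero => simp
  | add z w hz hw => simp only [tmul_add, map_add, smul_add, hz, hw]
  | tmul y x =>
    rw [antipodeTwist_smulLift_diagMul_tmul, lTensor_coactLin,
      HopfAlgebra.mul_antipode_rTensor_comul_apply, LinearMap.lTensor_tmul, antipodeTwist_tmul,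
      Algebra.algebraMap_eq_smul_one, mul_smul_comm, mul_one, ← smul_tmul', map_smul]
    rfl

theorem antipodeTwist_cofreeLift_smulLift (δ : Deriv B) (t : B ⊗[ℂ] B) :
    antipodeTwist B δ.M
        (cofreeLift (formCoaction hB) ((smulLift (S := B) δ.d).restrictScalars ℂ) t) =
      maurerCartan hB δ.d (Deriv.counitPlus B t) := by
  induction t with
  | zero => simp
  | add t t' ht ht' => simp only [map_add, Submodule.coe_add, ht, ht']
  | tmul a b =>
    rw [Deriv.counitPlus_tmul, Submodule.coe_smul, map_smul, maurerCartan_plus]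
    exact antipodeTwist_smulLift_diagMul_coactLin hB δ.d a (coactLin hB b)

variable {hB} in
theorem Deriv.IsEquivariant.maurerCartan_eq_zero {δ : Deriv B} (hδ : δ.IsEquivariant hB)
    {r : Bplus B} (hr : r ∈ δ.toRightIdeal.carrier) : maurerCartan hB δ.d r = 0 := by
  obtain ⟨t, ht, rfl⟩ := hr
  have ker_le : LinearMap.ker δ.formLin ≤
      LinearMap.ker ((smulLift (S := B) δ.d).restrictScalars ℂ) := fun t ht => by
    rw [LinearMap.mem_ker, LinearMap.restrictScalars_apply, ← Deriv.coe_formLin,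
      LinearMap.mem_ker.1 ht, Submodule.coe_zero]
  have h : cofreeLift (formCoaction hB) ((smulLift (S := B) δ.d).restrictScalars ℂ) t = 0 :=
    ker_lTensor_le_ker_lTensor A ker_le (Deriv.isEquivariant_iff_ker_formLin_le.1 hδ ht)
  rw [← antipodeTwist_cofreeLift_smulLift, h, map_zero]

theorem Deriv.IsEquivariant.le_derivOf_toRightIdeal {hB : IsLeftCoideal B} {δ : Deriv B}
    (hδ : δ.IsEquivariant hB) (hflat : IsFaithfullyFlatRight B) :
    δ ≤ derivOf δ.toRightIdeal hB := by
  rw [Deriv.le_iff_ker_formLin_le, ker_formLin_derivOf]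
  intro t ht
  set σ := maurerCartan hB δ.d ∘ₗ (Bplus B).subtype
  set z := cofreeLift (formCoaction hB) (Deriv.counitPlus B) t with hz
  have ker_le : LinearMap.ker δ.toRightIdeal.carrier.mkQ ≤ LinearMap.ker σ := by
    rw [Submodule.ker_mkQ]
    exact fun r hr => hδ.maurerCartan_eq_zero hr
  have lTensor_mkQ : δ.toRightIdeal.carrier.mkQ.lTensor A z = 0 := by
    rw [hz, cofreeLift, LinearMap.comp_apply, ← LinearMap.lTensor_comp_apply]
    exact ht
  have smulLift_eq_zero : smulLift (S := A) σ z = 0 := by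
    rw [← LinearMap.id_comp σ, ← smulLift_lTensor,
      LinearMap.mem_ker.1 (ker_lTensor_le_ker_lTensor A ker_le lTensor_mkQ), map_zero]
  rw [LinearMap.mem_ker, ← Submodule.coe_eq_zero]
  refine hflat.eq_zero_of_mkQ_tmul_eq_zero ?_
  rw [← smulLift_maurerCartan_cofreeLift_counitPlus hB, smulLift_eq_zero]

end MaurerCartan

section Recovery

variable {M V : Type u} [AddCommGroup M] [Module ℂ M] [Module B M] [AddCommGroup V] [Module ℂ V]
  (hB : IsLeftCoideal B)

/-- The linear map `A ⊗_B M → V`, `a ⊗ m ↦ ε(a) π(m)`. -/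
def counitLift (π : M →ₗ[ℂ] V) (hπ : ∀ (b : B) (m : M), π (b • m) = counitB B b • π m) :
    TensorB B M →ₗ[ℂ] V :=
  (balanced B M).liftQ (TensorProduct.lid ℂ V ∘ₗ TensorProduct.map Coalgebra.counit π) <|
    Submodule.span_le.2 <| by
      rintro _ ⟨a, b, m, rfl⟩
      simp [hπ, counitB, smul_tmul', mul_comm]

variable {π : M →ₗ[ℂ] V} (hπ : ∀ (b : B) (m : M), π (b • m) = counitB B b • π m)

theorem counitLift_antipodeTwist (z : A ⊗[ℂ] M) :
    counitLift π hπ (antipodeTwist B M z) =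
      π (TensorProduct.lid ℂ M (Coalgebra.counit.rTensor M z)) := by
  induction z with
  | zero => simp
  | add z w hz hw => simp only [map_add, hz, hw]
  | tmul a m =>
    calc Coalgebra.counit (R := ℂ) (HopfAlgebra.antipode ℂ a) • π m
      _ = π (Coalgebra.counit (R := ℂ) a • m) := by rw [HopfAlgebra.counit_antipode, map_smul]

theorem counitLift_maurerCartan (d : B →ₗ[ℂ] M) (b : B) :
    counitLift π hπ (maurerCartan hB d b) = π (d b) := by
  rw [maurerCartan, LinearMap.comp_apply, counitLift_antipodeTwist,
    (isCoaction_coactLin hB).counit_cofreeLift, TensorProduct.lid_tmul, one_smul]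

theorem tensorBMap_antipodeTwist [IsScalarTower ℂ B M] {N : Type u} [AddCommGroup N] [Module ℂ N]
    [Module B N] [IsScalarTower ℂ B N] (f : M →ₗ[B] N) (z : A ⊗[ℂ] M) :
    tensorBMap f (antipodeTwist B M z) =
      antipodeTwist B N ((f.restrictScalars ℂ).lTensor A z) := by
  have h : tensorBMap f ∘ₗ antipodeTwist B M =
      antipodeTwist B N ∘ₗ (f.restrictScalars ℂ).lTensor A := TensorProduct.ext' fun _ _ => rfl
  exact LinearMap.congr_fun h z

theorem counitPlus_smul (b : B) (t : B ⊗[ℂ] B) :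
    Deriv.counitPlus B (b • t) = counitB B b • Deriv.counitPlus B t := by
  induction t with
  | zero => simp
  | add t t' ht ht' => simp only [smul_add, map_add, ht, ht']
  | tmul a c => simp only [smul_tmul', smul_eq_mul, Deriv.counitPlus_tmul, counitB_mul, mul_smul]

variable {hB} in
theorem Deriv.plus_mem_toRightIdeal (hflat : IsFaithfullyFlatRight B) {δ : Deriv B} {b : B}
    (hb : maurerCartan hB δ.d b = 0) : plus B b ∈ δ.toRightIdeal.carrier := by
  set f : B ⊗[ℂ] B →ₗ[B] δ.M := smulLift δ.d
  set ω := maurerCartan hB (TensorProduct.mk ℂ B B 1) b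
  have tensorBMap_ω : tensorBMap f ω = 0 := by
    have h : f.restrictScalars ℂ ∘ₗ TensorProduct.mk ℂ B B 1 = δ.d :=
      LinearMap.ext fun c => one_smul B (δ.d c)
    rw [← hb, maurerCartan, cofreeLift, ← h, LinearMap.lTensor_comp]
    exact tensorBMap_antipodeTwist f _
  obtain ⟨y, hy⟩ := (hflat.exact_tensorBMap_ker_subtype f ω).1 tensorBMap_ω
  have counitLift_ker : δ.toRightIdeal.carrier.mkQ ∘ₗ
      counitLift (Deriv.counitPlus B) counitPlus_smul ∘ₗ
        tensorBMap (M := LinearMap.ker f) (LinearMap.ker f).subtype = 0 := by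
    refine tensorB_hom_ext fun a t => (Submodule.Quotient.mk_eq_zero _).2 ?_
    refine Submodule.smul_mem _ (Coalgebra.counit (R := ℂ) a) ⟨t, ?_, rfl⟩
    rw [SetLike.mem_coe, LinearMap.mem_ker, ← Submodule.coe_eq_zero, δ.coe_formLin]
    exact t.2
  have plus_eq : plus B b = counitLift (Deriv.counitPlus B) counitPlus_smul ω := by
    rw [counitLift_maurerCartan, TensorProduct.mk_apply, Deriv.counitPlus_tmul, counitB_one,
      one_smul]
  rw [plus_eq, ← hy, ← Submodule.ker_mkQ δ.toRightIdeal.carrier]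
  exact LinearMap.congr_fun counitLift_ker y

variable (B V) in
/-- The linear map `A ⊗ V → A ⊗_B (A ⊗ V)`, `a ⊗ v ↦ S(a₍₁₎) ⊗ (a₍₂₎ ⊗ v)`. -/
def antipodeSplit : A ⊗[ℂ] V →ₗ[ℂ] TensorB B (A ⊗[ℂ] V) :=
  antipodeTwist B (A ⊗[ℂ] V) ∘ₗ TensorProduct.assoc ℂ A A V ∘ₗ Coalgebra.comul.rTensor V

theorem antipodeSplit_cofreeLift (π : B →ₗ[ℂ] V) (b : B) :
    antipodeSplit B V (cofreeLift (coactLin hB) π b) =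
      maurerCartan hB (cofreeLift (coactLin hB) π) b :=
  congrArg (antipodeTwist B (A ⊗[ℂ] V)) ((isCoaction_coactLin hB).assoc_comul_cofreeLift π b)

theorem assoc_val_mul_tmul (s : A ⊗[ℂ] B) (p : A ⊗[ℂ] A) (v : V) :
    TensorProduct.assoc ℂ A A V ((B.val.toLinearMap.lTensor A s * p) ⊗ₜ v) =
      ((smulLift (S := B) (LinearMap.id : A ⊗[ℂ] V →ₗ[ℂ] A ⊗[ℂ] V)).restrictScalars ℂ).lTensor A
        (diagMul B (A ⊗[ℂ] V) (s ⊗ₜ TensorProduct.assoc ℂ A A V (p ⊗ₜ v))) := by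
  induction s with
  | zero => simp
  | add s s' hs hs' => simp only [add_tmul, map_add, add_mul, hs, hs']
  | tmul x b =>
    induction p with
    | zero => simp
    | add p p' hp hp' => simp only [mul_add, add_tmul, tmul_add, map_add, hp, hp']
    | tmul a c =>
      rw [LinearMap.lTensor_tmul, Algebra.TensorProduct.tmul_mul_tmul, assoc_tmul, assoc_tmul,
        diagMul_tmul]
      rfl

include hB in
theorem antipodeSplit_val_mul_tmul (b : B) (a : A) (v : V) :
    antipodeSplit B V ((b * a) ⊗ₜ v) = counitB B b • antipodeSplit B V (a ⊗ₜ v) := by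
  rw [antipodeSplit, LinearMap.comp_apply, LinearMap.comp_apply, LinearMap.rTensor_tmul,
    Bialgebra.comul_mul, ← lTensor_coactLin hB]
  refine (congrArg _ (assoc_val_mul_tmul _ _ _)).trans ?_
  rw [antipodeTwist_smulLift_diagMul_coactLin, LinearMap.lTensor_id_apply]
  rfl

include hB in
theorem antipodeSplit_eq_zero {z : A ⊗[ℂ] V} (hz : (BplusA B).mkQ.rTensor V z = 0) :
    antipodeSplit B V z = 0 := by
  have exact : Function.Exact ((BplusA B).subtype.rTensor V) ((BplusA B).mkQ.rTensor V) :=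
    rTensor_exact V (LinearMap.exact_subtype_mkQ _) (BplusA B).mkQ_surjective
  obtain ⟨y, rfl⟩ := (exact z).1 hz
  have tmul_eq_zero (v : V) : BplusA B ≤
      LinearMap.ker (antipodeSplit B V ∘ₗ (TensorProduct.mk ℂ A V).flip v) := by
    refine Submodule.span_le.2 ?_
    rintro _ ⟨b, hb, a, rfl⟩
    have h := antipodeSplit_val_mul_tmul hB b a v
    rwa [show counitB B b = 0 from hb, zero_smul] at h
  have h : antipodeSplit B V ∘ₗ (BplusA B).subtype.rTensor V = 0 :=
    TensorProduct.ext' fun x v => tmul_eq_zero v x.2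
  exact LinearMap.congr_fun h y

theorem RightIdeal.IsStable.toRightIdeal_derivOf {R : RightIdeal B} (hR : R.IsStable)
    (hflat : IsFaithfullyFlatRight B) : (derivOf R hB).toRightIdeal = R := by
  refine RightIdeal.ext (le_antisymm (toRightIdeal_derivOf_le hB R) fun r hr => ?_)
  have maurerCartan_eq_zero : maurerCartan hB (dLin R hB) r = 0 := by
    refine (antipodeSplit_cofreeLift hB _ _).symm.trans ?_
    exact antipodeSplit_eq_zero hB ((isStable_iff_mkQ_rTensor_dLin_eq_zero hB).1 hR r hr)
  have h : plus B r ∈ (derivOf R hB).toRightIdeal.carrier :=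
    Deriv.plus_mem_toRightIdeal hflat maurerCartan_eq_zero
  have plus_r : plus B (r : B) = r :=
    Subtype.ext (by rw [coe_plus, show counitB B (r : B) = 0 from r.2, zero_smul, sub_zero])
  rwa [plus_r] at h

end Recovery

end QHS

end

theorem theorem2 {A : Type u} [Ring A] [HopfAlgebra ℂ A] (B : Subalgebra ℂ A)
    (hB : QHS.IsLeftCoideal B) (hflat : QHS.IsFaithfullyFlatRight B) :
    Set.BijOn (QHS.RightIdeal.toDeriv hB)
        {R : QHS.RightIdeal B | R.IsStable} {δ : QHS.DerivClass B | δ.IsEquivariant hB} ∧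
      Set.BijOn QHS.DerivClass.toRightIdeal
        {δ : QHS.DerivClass B | δ.IsEquivariant hB} {R : QHS.RightIdeal B | R.IsStable} ∧
      Set.InvOn QHS.DerivClass.toRightIdeal (QHS.RightIdeal.toDeriv hB)
        {R : QHS.RightIdeal B | R.IsStable} {δ : QHS.DerivClass B | δ.IsEquivariant hB} := by
  have hinv : Set.InvOn QHS.DerivClass.toRightIdeal (QHS.RightIdeal.toDeriv hB)
      {R : QHS.RightIdeal B | R.IsStable} {δ : QHS.DerivClass B | δ.IsEquivariant hB} := by
    refine ⟨fun R hR => QHS.RightIdeal.IsStable.toRightIdeal_derivOf hB hR hflat, fun δ hδ => ?_⟩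
    induction δ using Quotient.inductionOn with
    | h δ =>
      have hδ' : δ.IsEquivariant hB := hδ
      exact Quotient.sound ⟨hδ'.derivOf_toRightIdeal_le, hδ'.le_derivOf_toRightIdeal hflat⟩
  have mapsTo_toDeriv : Set.MapsTo (QHS.RightIdeal.toDeriv hB)
      {R : QHS.RightIdeal B | R.IsStable} {δ : QHS.DerivClass B | δ.IsEquivariant hB} :=
    fun R _ => QHS.isEquivariant_derivOf hB R
  have mapsTo_toRightIdeal : Set.MapsTo QHS.DerivClass.toRightIdeal
      {δ : QHS.DerivClass B | δ.IsEquivariant hB} {R : QHS.RightIdeal B | R.IsStable} := by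
    intro δ hδ
    induction δ using Quotient.inductionOn with
    | h δ => exact QHS.Deriv.IsEquivariant.isStable_toRightIdeal hδ
  exact ⟨hinv.bijOn mapsTo_toDeriv mapsTo_toRightIdeal,
    hinv.symm.bijOn mapsTo_toRightIdeal mapsTo_toDeriv, hinv⟩
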